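/- Let $k\ge 2$ and $d\ge 1$ be integers and let $0<\theta<1$ satisfy $d\theta>1$. Let $p\in(1,\infty)$ be determined by $d\theta=d^{1/p}$. \textbf{Sequences.} Let $\omega^{\not\downarrow\le k}$ (resp. $\omega^{\not\downarrow k}$) be the set of all non-decreasing sequences of elements of $\omega=\{0,1,2,\dots\}$ of length at most $k$ (resp. exactly $k$), and write $|s|$ for the length of $s$. Define $\prec$ as follows: $()\prec t$ for every nonempty $t$; and for nonempty sequences, $(s_1,\dots,s_i)\prec(t_1,\dots,t_j)$ iff $s_i<t_j$, or $s_i=t_j$ and $(s_1,\dots,s_i)$ is lexicographically below $(t_1,\dots,t_j)$ (a proper initial segment being lexicographically below the longer sequence). Write $s\sqsubset t$ if $s$ is a proper initial segment of $t$, and $s\sqsubseteq t$ if $s=t$ or $s\sqsubset t$. \textbf{Approximations.} An $\mathcal E_k$-tree is a map $\widehat X:\omega^{\not\downarrow\le k}\to\omega^{\not\downarrow\le k}$ that preserves $\prec$ and $\sqsubset$; it maps $\omega^{\not\downarrow k}$ into itself, and we let $X=\widehat X[\omega^{\not\downarrow k}]$. Let $r_n(X)$ be the set of the $\prec$-least $n$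 elements of $X$, and let $\mathcal{AR}^k$ be the family of all sets $r_n(X)$. For $m\le d$, nonempty sets $E_1,\dots,E_m\in\mathcal{AR}^k$ are called admissible if $E_1<\dots<E_m$, that is, every element of $E_i$ is $\prec$ every element of $E_j$ whenever $i<j$. \textbf{The space.} On the space $c_{00}(\omega^{\not\downarrow k})$ of finitely supported real functions, with unit vectors $e_v$, and with $Ex=\sum_{v\in E}x_ve_v$, put $|x|_0=\max_v|x_v|$, $$|x|_{j+1}=\max\Big\{|x|_j,\ \theta\sup\Big\{\sum_{i=1}^m|E_ix|_j:\ 1\le m\le d,\ (E_i)_{i=1}^m\text{ admissible}\Big\}\Big\},\qquad \|x\|=\sup_{j}|x|_j .$$ Let $T_k(d,\theta)$ be the completion of $c_{00}(\omega^{\not\downarrow k})$ under $\|\cdot\|$. \textbf{Statement.} \begin{enumerate} \item For every $s\in\omega^{\not\downarrow\le k}$ with $|s|=k-1$, the closed subspace $T^k[s]=\overline{\operatorname{span}}\{e_v: v\in\omega^{\not\downarrow k},\ s\sqsubseteq v\}$ of $T_k(d,\theta)$ is isomorphic (linearly homeomorphic) to $\ell_p$. \item For every $s=(s_1,\dots,s_l)\in\omega^{\not\downarrow\le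 k}$ with $l<k$, the closed subspace $D[s]=\overline{\operatorname{span}}\{e_{v_i}: i\ge 1\}$ of $T_k(d,\theta)$ is isomorphic to $\ell_p$, where $v_i=(s_1,\dots,s_l,s_l+i-1,\dots,s_l+i-1)$ has length $k$ (and $s_l$ is read as $0$ if $l=0$). \end{enumerate} -/

import Mathlib

namespace HDTsirelson

/-- `OmLE k` is the set of non-decreasing sequences of natural numbers of length at most `k`. -/
def OmLE (k : ℕ) : Type := {s : List ℕ // s.length ≤ k ∧ s.Pairwise (· ≤ ·)}

/-- `Om k` is the set of non-decreasing sequences of natural numbers of length exactly `k`. -/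
def Om (k : ℕ) : Type := {s : List ℕ // s.length = k ∧ s.Pairwise (· ≤ ·)}

/-- The inclusion of the sequences of length `k` into those of length at most `k`. -/
def Om.toOmLE {k : ℕ} (v : Om k) : OmLE k := ⟨v.1, v.2.1.le, v.2.2⟩

/-- The order `≺`: the empty sequence is the least element; two nonempty sequences are compared by
their last entries, and lexicographically if the last entries agree. -/
def Prec : List ℕ → List ℕ → Prop
  | _, [] => False
  | [], _ :: _ => True
  | a :: s, b :: t =>
      (a :: s).getLastD 0 < (b :: t).getLastD 0 ∨
        ((a :: s).getLastD 0 = (b :: t).getLastD 0 ∧ List.Lex (· < ·) (a :: s) (b :: t))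

/-- `s ⊏ t`: the sequence `s` is a proper initial segment of `t`. -/
def ProperInit (s t : List ℕ) : Prop := s <+: t ∧ s.length < t.length

/-- An `𝓔_k`-tree: a self-map of the sequences of length at most `k` which preserves
`≺` and `⊏`. -/
def IsTree {k : ℕ} (X : OmLE k → OmLE k) : Prop :=
  (∀ s t : OmLE k, Prec s.1 t.1 → Prec (X s).1 (X t).1) ∧
    ∀ s t : OmLE k, ProperInit s.1 t.1 → ProperInit (X s).1 (X t).1

/-- The member of `𝓔_k` given by a tree: the range of its restriction to the sequences of
length `k`. -/
def topRange {k : ℕ} (X : OmLE k → OmLE k) : Set (Om k) :=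
  {v | ∃ u : Om k, X u.toOmLE = v.toOmLE}

/-- `r_n(X)`: the `≺`-least `n` members of `X`, i.e. those having fewer than `n`
`≺`-predecessors in `X`. -/
def approx {k : ℕ} (n : ℕ) (X : Set (Om k)) : Set (Om k) :=
  {v | v ∈ X ∧ Set.encard {w | w ∈ X ∧ Prec w.1 v.1} < (n : ℕ∞)}

/-- The set `𝓐𝓡^k` of all finite approximations to members of `𝓔_k`. -/
def AR (k : ℕ) : Set (Set (Om k)) :=
  {E | ∃ X : OmLE k → OmLE k, IsTree X ∧ ∃ n : ℕ, E = approx n (topRange X)}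

/-- `E_1 < E_2 < ⋯ < E_m` with all `E_i` nonempty members of `𝓐𝓡^k`. -/
def Admissible {k m : ℕ} (E : Fin m → Set (Om k)) : Prop :=
  (∀ i, E i ∈ AR k ∧ (E i).Nonempty) ∧
    ∀ i j, i < j → ∀ v ∈ E i, ∀ w ∈ E j, Prec v.1 w.1

open Classical in
/-- `E x`, the restriction of a finitely supported vector to a set of coordinates. -/
noncomputable def restrict {k : ℕ} (E : Set (Om k)) (x : Om k →₀ ℝ) : Om k →₀ ℝ :=
  x.filter (· ∈ E)

/-- The norms `|x|_j`. -/
noncomputable def level (k d : ℕ) (θ : ℝ) : ℕ → (Om k →₀ ℝ) → ℝ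
  | 0, x => ⨆ v, |x v|
  | j + 1, x => max (level k d θ j x)
      (θ * sSup {r : ℝ | ∃ m : ℕ, 1 ≤ m ∧ m ≤ d ∧ ∃ E : Fin m → Set (Om k), Admissible E ∧
        r = ∑ i, level k d θ j (restrict (E i) x)})

/-- The norm of `T_k(d, θ)` on finitely supported vectors, `‖x‖ = sup_j |x|_j`. -/
noncomputable def tnorm (k d : ℕ) (θ : ℝ) (x : Om k →₀ ℝ) : ℝ := ⨆ j, level k d θ j x

/-! Proof that `tnorm` is a norm when `0 < θ < 1`. -/

section NormFacts

variable {k d : ℕ} {θ : ℝ}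

/-- The `ℓ_1` norm. -/
noncomputable def l1 (x : Om k →₀ ℝ) : ℝ := ∑ v ∈ x.support, |x v|

theorem prec_irrefl (s : List ℕ) : ¬ Prec s s := by
  cases s with
  | nil => simp [Prec]
  | cons a s =>
    simp only [Prec, lt_self_iff_false, false_or, true_and]
    exact List.lex_irrefl lt_irrefl (a :: s)

theorem restrict_apply (E : Set (Om k)) [DecidablePred (· ∈ E)] (x : Om k →₀ ℝ) (v : Om k) :
    restrict E x v = if v ∈ E then x v else 0 := by
  simp only [restrict, Finsupp.filter_apply]
  congr

theorem l1_nonneg (x : Om k →₀ ℝ) : 0 ≤ l1 x := Finset.sum_nonneg fun _ _ => abs_nonneg _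

theorem abs_le_l1 (x : Om k →₀ ℝ) (v : Om k) : |x v| ≤ l1 x := by
  by_cases hv : v ∈ x.support
  · exact Finset.single_le_sum (f := fun v => |x v|) (fun _ _ => abs_nonneg _) hv
  · rw [Finsupp.notMem_support_iff.1 hv, abs_zero]; exact l1_nonneg x

theorem l1_restrict (E : Set (Om k)) (x : Om k →₀ ℝ) :
    l1 (restrict E x) = ∑ v ∈ x.support, |restrict E x v| := by
  refine Finset.sum_subset ?_ ?_
  · classical exact Finset.filter_subset _ _
  · intro v _ hv
    rw [Finsupp.notMem_support_iff.1 hv, abs_zero]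

theorem sum_l1_restrict_le {m : ℕ} {E : Fin m → Set (Om k)} (hE : Admissible E)
    (x : Om k →₀ ℝ) : ∑ i, l1 (restrict (E i) x) ≤ l1 x := by
  classical
  simp only [l1_restrict]
  rw [Finset.sum_comm]
  refine Finset.sum_le_sum fun v _ => ?_
  by_cases h : ∃ i, v ∈ E i
  · obtain ⟨i, hi⟩ := h
    rw [Finset.sum_eq_single i]
    · simp [restrict_apply, hi]
    · intro j _ hji
      have hj : v ∉ E j := by
        intro hj
        rcases lt_or_gt_of_ne hji with h | h
        · exact prec_irrefl _ (hE.2 j i h v hj v hi)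
        · exact prec_irrefl _ (hE.2 i j h v hi v hj)
      simp [restrict_apply, hj]
    · simp
  · push Not at h
    simp [restrict_apply, h]

theorem bddAbove_level_zero (x : Om k →₀ ℝ) : BddAbove (Set.range fun v => |x v|) :=
  ⟨l1 x, by rintro _ ⟨v, rfl⟩; exact abs_le_l1 x v⟩

theorem level_nonneg (j : ℕ) (x : Om k →₀ ℝ) : 0 ≤ level k d θ j x := by
  induction j generalizing x with
  | zero => exact Real.iSup_nonneg fun v => abs_nonneg (x v)
  | succ j ih => exact le_max_of_le_left (ih x)

theorem level_le_l1 (h0 : 0 < θ) (h1 : θ < 1) (j : ℕ) (x : Om k →₀ ℝ) :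
    level k d θ j x ≤ l1 x := by
  induction j generalizing x with
  | zero => exact Real.iSup_le (fun v => abs_le_l1 x v) (l1_nonneg x)
  | succ j ih =>
    refine max_le (ih x) ?_
    have : sSup {r : ℝ | ∃ m : ℕ, 1 ≤ m ∧ m ≤ d ∧ ∃ E : Fin m → Set (Om k), Admissible E ∧
        r = ∑ i, level k d θ j (restrict (E i) x)} ≤ l1 x := by
      refine Real.sSup_le ?_ (l1_nonneg x)
      rintro r ⟨m, _, _, E, hE, rfl⟩
      exact (Finset.sum_le_sum fun i _ => ih _).trans (sum_l1_restrict_le hE x)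
    nlinarith [l1_nonneg x]

theorem bddAbove_admissible (h0 : 0 < θ) (h1 : θ < 1) (j : ℕ) (x : Om k →₀ ℝ) :
    BddAbove {r : ℝ | ∃ m : ℕ, 1 ≤ m ∧ m ≤ d ∧ ∃ E : Fin m → Set (Om k), Admissible E ∧
        r = ∑ i, level k d θ j (restrict (E i) x)} := by
  refine ⟨l1 x, ?_⟩
  rintro r ⟨m, _, _, E, hE, rfl⟩
  exact (Finset.sum_le_sum fun i _ => level_le_l1 h0 h1 j _).trans (sum_l1_restrict_le hE x)

theorem sSup_admissible_nonneg (j : ℕ) (x : Om k →₀ ℝ) :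
    0 ≤ sSup {r : ℝ | ∃ m : ℕ, 1 ≤ m ∧ m ≤ d ∧ ∃ E : Fin m → Set (Om k), Admissible E ∧
        r = ∑ i, level k d θ j (restrict (E i) x)} := by
  refine Real.sSup_nonneg ?_
  rintro r ⟨m, _, _, E, hE, rfl⟩
  exact Finset.sum_nonneg fun i _ => level_nonneg j _

theorem level_add_le (h0 : 0 < θ) (h1 : θ < 1) (j : ℕ) (x y : Om k →₀ ℝ) :
    level k d θ j (x + y) ≤ level k d θ j x + level k d θ j y := by
  induction j generalizing x y with
  | zero =>
    refine Real.iSup_le (fun v => ?_)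
      (add_nonneg (level_nonneg (d := d) (θ := θ) 0 x) (level_nonneg (d := d) (θ := θ) 0 y))
    exact (abs_add_le (x v) (y v)).trans
      (add_le_add (le_ciSup (bddAbove_level_zero x) v) (le_ciSup (bddAbove_level_zero y) v))
  | succ j ih =>
    refine max_le ((ih x y).trans (add_le_add (le_max_left _ _) (le_max_left _ _))) ?_
    refine le_trans ?_ (add_le_add (le_max_right _ _) (le_max_right _ _))
    rw [← mul_add]
    refine mul_le_mul_of_nonneg_left ?_ h0.le
    refine Real.sSup_le ?_ (add_nonneg (sSup_admissible_nonneg j x) (sSup_admissible_nonneg j y))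
    rintro r ⟨m, hm1, hmd, E, hE, rfl⟩
    refine le_trans ?_ (add_le_add
      (le_csSup (bddAbove_admissible h0 h1 j x) ⟨m, hm1, hmd, E, hE, rfl⟩)
      (le_csSup (bddAbove_admissible h0 h1 j y) ⟨m, hm1, hmd, E, hE, rfl⟩))
    rw [← Finset.sum_add_distrib]
    refine Finset.sum_le_sum fun i _ => ?_
    have : restrict (E i) (x + y) = restrict (E i) x + restrict (E i) y := by
      classical exact Finsupp.filter_add
    rw [this]
    exact ih _ _

theorem level_smul_le (h0 : 0 < θ) (h1 : θ < 1) (j : ℕ) (c : ℝ) (x : Om k →₀ ℝ) :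
    level k d θ j (c • x) ≤ |c| * level k d θ j x := by
  induction j generalizing x with
  | zero =>
    refine Real.iSup_le (fun v => ?_)
      (mul_nonneg (abs_nonneg c) (level_nonneg (d := d) (θ := θ) 0 x))
    rw [Finsupp.smul_apply, smul_eq_mul, abs_mul]
    exact mul_le_mul_of_nonneg_left (le_ciSup (bddAbove_level_zero x) v) (abs_nonneg c)
  | succ j ih =>
    refine max_le ((ih x).trans (mul_le_mul_of_nonneg_left (le_max_left _ _) (abs_nonneg c))) ?_
    refine le_trans ?_ (mul_le_mul_of_nonneg_left (le_max_right _ _) (abs_nonneg c))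
    rw [mul_left_comm]
    refine mul_le_mul_of_nonneg_left ?_ h0.le
    refine Real.sSup_le ?_ (mul_nonneg (abs_nonneg c) (sSup_admissible_nonneg j x))
    rintro r ⟨m, hm1, hmd, E, hE, rfl⟩
    refine le_trans ?_ (mul_le_mul_of_nonneg_left
      (le_csSup (bddAbove_admissible h0 h1 j x) ⟨m, hm1, hmd, E, hE, rfl⟩) (abs_nonneg c))
    rw [Finset.mul_sum]
    refine Finset.sum_le_sum fun i _ => ?_
    have : restrict (E i) (c • x) = c • restrict (E i) x := by
      classical exact Finsupp.filter_smul
    rw [this]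
    exact ih _

theorem bddAbove_level (h0 : 0 < θ) (h1 : θ < 1) (x : Om k →₀ ℝ) :
    BddAbove (Set.range fun j => level k d θ j x) :=
  ⟨l1 x, by rintro _ ⟨j, rfl⟩; exact level_le_l1 h0 h1 j x⟩

theorem tnorm_nonneg (x : Om k →₀ ℝ) : 0 ≤ tnorm k d θ x :=
  Real.iSup_nonneg fun j => level_nonneg j x

theorem tnorm_add_le (h0 : 0 < θ) (h1 : θ < 1) (x y : Om k →₀ ℝ) :
    tnorm k d θ (x + y) ≤ tnorm k d θ x + tnorm k d θ y :=
  Real.iSup_le (fun j => (level_add_le h0 h1 j x y).trans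
    (add_le_add (le_ciSup (bddAbove_level h0 h1 x) j) (le_ciSup (bddAbove_level h0 h1 y) j)))
    (add_nonneg (tnorm_nonneg x) (tnorm_nonneg y))

theorem tnorm_smul_le (h0 : 0 < θ) (h1 : θ < 1) (c : ℝ) (x : Om k →₀ ℝ) :
    tnorm k d θ (c • x) ≤ |c| * tnorm k d θ x :=
  Real.iSup_le (fun j => (level_smul_le h0 h1 j c x).trans
    (mul_le_mul_of_nonneg_left (le_ciSup (bddAbove_level h0 h1 x) j) (abs_nonneg c)))
    (mul_nonneg (abs_nonneg c) (tnorm_nonneg x))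

theorem tnorm_smul (h0 : 0 < θ) (h1 : θ < 1) (c : ℝ) (x : Om k →₀ ℝ) :
    tnorm k d θ (c • x) = |c| * tnorm k d θ x := by
  refine le_antisymm (tnorm_smul_le h0 h1 c x) ?_
  rcases eq_or_ne c 0 with rfl | hc
  · simpa using tnorm_nonneg (k := k) (d := d) (θ := θ) (0 : Om k →₀ ℝ)
  · have h := tnorm_smul_le (d := d) h0 h1 c⁻¹ (c • x)
    rw [smul_smul, inv_mul_cancel₀ hc, one_smul, abs_inv] at h
    have hc' : 0 < |c| := abs_pos.2 hc
    calc |c| * tnorm k d θ x ≤ |c| * (|c|⁻¹ * tnorm k d θ (c • x)) :=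
          mul_le_mul_of_nonneg_left h hc'.le
      _ = tnorm k d θ (c • x) := by rw [← mul_assoc, mul_inv_cancel₀ hc'.ne', one_mul]

theorem abs_le_tnorm (h0 : 0 < θ) (h1 : θ < 1) (x : Om k →₀ ℝ) (v : Om k) :
    |x v| ≤ tnorm k d θ x :=
  (le_ciSup (bddAbove_level_zero x) v).trans (le_ciSup (bddAbove_level (d := d) h0 h1 x) 0)

theorem tnorm_eq_zero_iff (h0 : 0 < θ) (h1 : θ < 1) (x : Om k →₀ ℝ) :
    tnorm k d θ x = 0 ↔ x = 0 := by
  constructor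
  · intro h
    ext v
    have := abs_le_tnorm (d := d) h0 h1 x v
    rw [h] at this
    exact abs_nonpos_iff.1 this
  · rintro rfl
    simpa using tnorm_smul (k := k) (d := d) h0 h1 0 0

end NormFacts

/-- The vector space `c_00` of finitely supported real functions on the sequences of length `k`,
to be normed by `tnorm k d θ`. -/
def C00 (k _d : ℕ) (_θ : Set.Ioo (0 : ℝ) 1) : Type := Om k →₀ ℝ

noncomputable instance (k d : ℕ) (θ : Set.Ioo (0 : ℝ) 1) : AddCommGroup (C00 k d θ) :=
  inferInstanceAs (AddCommGroup (Om k →₀ ℝ))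

noncomputable instance (k d : ℕ) (θ : Set.Ioo (0 : ℝ) 1) : Module ℝ (C00 k d θ) :=
  inferInstanceAs (Module ℝ (Om k →₀ ℝ))

noncomputable instance (k d : ℕ) (θ : Set.Ioo (0 : ℝ) 1) : Norm (C00 k d θ) :=
  ⟨fun x => tnorm k d θ.1 x⟩

theorem c00_core (k d : ℕ) (θ : Set.Ioo (0 : ℝ) 1) : NormedSpace.Core ℝ (C00 k d θ) where
  norm_nonneg x := tnorm_nonneg (k := k) (d := d) (θ := θ.1) x
  norm_smul c x := tnorm_smul (k := k) (d := d) θ.2.1 θ.2.2 c x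
  norm_triangle x y := tnorm_add_le (k := k) (d := d) θ.2.1 θ.2.2 x y
  norm_eq_zero_iff x := tnorm_eq_zero_iff (k := k) (d := d) θ.2.1 θ.2.2 x

noncomputable instance (k d : ℕ) (θ : Set.Ioo (0 : ℝ) 1) : NormedAddCommGroup (C00 k d θ) :=
  NormedAddCommGroup.ofCore (c00_core k d θ)

noncomputable instance (k d : ℕ) (θ : Set.Ioo (0 : ℝ) 1) : NormedSpace ℝ (C00 k d θ) :=
  NormedSpace.ofCore (c00_core k d θ)

/-- The Banach space `T_k(d, θ)`, the completion of `c_00` under `tnorm k d θ`. -/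
abbrev T (k d : ℕ) (θ : Set.Ioo (0 : ℝ) 1) : Type := UniformSpace.Completion (C00 k d θ)

/-- The unit vector `e_v`. -/
noncomputable def e {k : ℕ} (d : ℕ) (θ : Set.Ioo (0 : ℝ) 1) (v : Om k) : T k d θ :=
  ((show C00 k d θ from Finsupp.single v (1 : ℝ)) : UniformSpace.Completion (C00 k d θ))

/-- `T^k[s]`: the closed linear span of the `e_v` such that `s` is an initial segment of `v`. -/
noncomputable def topTree {k : ℕ} (d : ℕ) (θ : Set.Ioo (0 : ℝ) 1) (s : OmLE k) :
    Submodule ℝ (T k d θ) :=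
  (Submodule.span ℝ (e d θ '' {v : Om k | s.1 <+: v.1})).topologicalClosure

/-- For `s = (s_1, …, s_l)`, the sequence `(s_1, …, s_l, s_l + i, …, s_l + i)` of length `k`
(with `s_l` read as `0` when `s` is empty). -/
def diagSeq {k : ℕ} (s : OmLE k) (i : ℕ) : Om k :=
  ⟨s.1 ++ List.replicate (k - s.1.length) (s.1.getLastD 0 + i), by
    obtain ⟨s, hs, hs'⟩ := s
    refine ⟨by simp; omega, ?_⟩
    rw [List.pairwise_append]
    refine ⟨hs', List.pairwise_replicate.2 (Or.inr le_rfl), ?_⟩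
    intro a ha b hb
    rw [(List.mem_replicate.1 hb).2]
    simp only at ha
    have hne : s ≠ [] := List.ne_nil_of_mem ha
    have hlast : a ≤ s.getLast hne := by
      rw [← List.dropLast_append_getLast hne, List.pairwise_append] at hs'
      rw [← List.dropLast_append_getLast hne, List.mem_append] at ha
      rcases ha with ha | ha
      · exact hs'.2.2 a ha _ (by simp)
      · exact (List.mem_singleton.1 ha).le
    have : s.getLastD 0 = s.getLast hne := by
      cases s with
      | nil => exact absurd rfl hne
      | cons a s => simp [List.getLastD]
    simp only [this]
    omega⟩

/-- `D[s]`: the closed linear span of the `e_v`, `v` running over the diagonal sequences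
above `s`. -/
noncomputable def diagSpace {k : ℕ} (d : ℕ) (θ : Set.Ioo (0 : ℝ) 1) (s : OmLE k) :
    Submodule ℝ (T k d θ) :=
  (Submodule.span ℝ (Set.range fun i : ℕ => e d θ (diagSeq s i))).topologicalClosure

/-- The real sequence space `ℓ_p`, for a real number `p`. -/
abbrev EllP (p : ℝ) : Type := lp (fun _ : ℕ => ℝ) (ENNReal.ofReal p)

theorem fact_one_le_ofReal {p : ℝ} (hp : 1 < p) : Fact (1 ≤ ENNReal.ofReal p) :=
  ⟨by simpa using hp.le⟩

end HDTsirelson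

namespace HDTsirelson

/-- The position of a sequence in the order `≺`, as an element of a linear order. -/
def precKey (s : List ℕ) : ℕ ×ₗ List ℕ := toLex (s.getLastD 0, s)

theorem precKey_lt_iff {s t : List ℕ} :
    precKey s < precKey t ↔ s.getLastD 0 < t.getLastD 0 ∨ (s.getLastD 0 = t.getLastD 0 ∧ s < t) :=
  Prod.Lex.lt_iff

theorem prec_iff {s t : List ℕ} : Prec s t ↔ precKey s < precKey t := by
  rw [precKey_lt_iff]
  cases t with
  | nil => simp [Prec]
  | cons b t =>
    cases s with
    | nil =>
      simp only [Prec, true_iff]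
      rcases Nat.eq_zero_or_pos ((b :: t).getLastD 0) with h | h
      · exact Or.inr ⟨by rw [h]; rfl, List.nil_lt_cons _ _⟩
      · exact Or.inl h
    | cons a s => rfl

theorem precKey_injective : Function.Injective precKey := fun _ _ h => congrArg (·.2) (toLex_inj.1 h)

theorem getLastD_le_of_precKey_le {s t : List ℕ} (h : precKey s ≤ precKey t) :
    s.getLastD 0 ≤ t.getLastD 0 := by
  rcases h.eq_or_lt with h | h
  · rw [precKey_injective h]
  · rcases precKey_lt_iff.1 h with h | h
    · exact h.le
    · exact h.1.le

theorem le_getLastD_of_mem {s : List ℕ} (hs : s.Pairwise (· ≤ ·)) {a : ℕ} (ha : a ∈ s) :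
    a ≤ s.getLastD 0 := by
  induction s using List.reverseRecOn with
  | nil => simp at ha
  | append_singleton s b _ =>
    rw [List.pairwise_append] at hs
    rw [List.mem_append] at ha
    have : (s ++ [b]).getLastD 0 = b := by simp [List.getLastD_eq_getLast?]
    rw [this]
    rcases ha with ha | ha
    · exact hs.2.2 a ha b (by simp)
    · exact (List.mem_singleton.1 ha).le

theorem getLastD_mem {s : List ℕ} (hs : s ≠ []) : s.getLastD 0 ∈ s := by
  rw [List.getLastD_eq_getLast?, List.getLast?_eq_some_getLast hs]
  exact List.getLast_mem hs

theorem getLastD_append_singleton (s : List ℕ) (b : ℕ) : (s ++ [b]).getLastD 0 = b := by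
  simp [List.getLastD_eq_getLast?]

/-- The sequence `u` with every entry `x` replaced by `c + x`, except that the zero entries
facing an entry of `s` are replaced by that entry. -/
def graft (c : ℕ) : List ℕ → List ℕ → List ℕ
  | _, [] => []
  | [], x :: u => (c + x) :: graft c [] u
  | a :: s, x :: u => (if x = 0 then a else c + x) :: graft c s u

theorem length_graft (c : ℕ) (s u : List ℕ) : (graft c s u).length = u.length := by
  induction u generalizing s with
  | nil => cases s <;> rfl
  | cons x u ih => cases s <;> simp [graft, ih]

theorem graft_append (c : ℕ) (s u w : List ℕ) :
    graft c s (u ++ w) = graft c s u ++ graft c (s.drop u.length) w := by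
  induction u generalizing s with
  | nil => cases s <;> rfl
  | cons x u ih => cases s <;> simp [graft, ih]

theorem graft_nil_left (c : ℕ) (u : List ℕ) : graft c [] u = u.map (c + ·) := by
  induction u with
  | nil => rfl
  | cons x u ih => simp [graft, ih]

theorem graft_replicate_append (c : ℕ) (s w : List ℕ) :
    graft c s (List.replicate s.length 0 ++ w) = s ++ w.map (c + ·) := by
  induction s with
  | nil => simp [graft_nil_left]
  | cons a s ih => simp [List.replicate_succ, graft, ih]

theorem graft_prefix (c : ℕ) (s : List ℕ) {u w : List ℕ} (h : u <+: w) :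
    graft c s u <+: graft c s w := by
  obtain ⟨t, rfl⟩ := h
  exact ⟨_, (graft_append c s u t).symm⟩

theorem graft_singleton (c : ℕ) (s : List ℕ) {x : ℕ} (hx : x ≠ 0) : graft c s [x] = [c + x] := by
  cases s <;> simp [graft, hx]

theorem getLastD_graft {c : ℕ} {s u : List ℕ} (hu : u.getLastD 0 ≠ 0) :
    (graft c s u).getLastD 0 = c + u.getLastD 0 := by
  induction u using List.reverseRecOn with
  | nil => simp at hu
  | append_singleton u x _ =>
    rw [getLastD_append_singleton] at hu ⊢
    rw [graft_append, graft_singleton c _ hu, getLastD_append_singleton]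

theorem le_of_mem_graft {c M : ℕ} {s u : List ℕ} (hs : ∀ a ∈ s, a ≤ c) (hu : ∀ x ∈ u, x ≤ M) :
    ∀ y ∈ graft c s u, y ≤ c + M := by
  induction u generalizing s with
  | nil => cases s <;> simp [graft]
  | cons x u ih =>
    have hx := hu x (by simp)
    have hu' : ∀ x ∈ u, x ≤ M := fun y hy => hu y (by simp [hy])
    cases s with
    | nil =>
      intro y hy
      rcases List.mem_cons.1 hy with rfl | hy
      · omega
      · exact ih (by simp) hu' y hy
    | cons a s =>
      intro y hy
      have ha := hs a (by simp)
      rcases List.mem_cons.1 hy with rfl | hy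
      · split_ifs <;> omega
      · exact ih (fun b hb => hs b (by simp [hb])) hu' y hy

theorem getLastD_graft_le {c : ℕ} {s u : List ℕ} (hs : ∀ a ∈ s, a ≤ c)
    (hu : u.Pairwise (· ≤ ·)) : (graft c s u).getLastD 0 ≤ c + u.getLastD 0 := by
  by_cases h : graft c s u = []
  · simp [h]
  · exact le_of_mem_graft hs (fun x hx => le_getLastD_of_mem hu hx) _ (getLastD_mem h)

theorem le_of_mem_graft' {c b : ℕ} {s u : List ℕ} (hs : ∀ a ∈ s, b ≤ a) (hb : b ≤ c) :
    ∀ y ∈ graft c s u, b ≤ y := by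
  induction u generalizing s with
  | nil => cases s <;> simp [graft]
  | cons x u ih =>
    cases s with
    | nil =>
      intro y hy
      rcases List.mem_cons.1 hy with rfl | hy
      · omega
      · exact ih (by simp) y hy
    | cons a s =>
      intro y hy
      have ha := hs a (by simp)
      rcases List.mem_cons.1 hy with rfl | hy
      · split_ifs <;> omega
      · exact ih (fun b hb => hs b (by simp [hb])) y hy

theorem add_le_of_mem_graft {c b : ℕ} {s u : List ℕ} (hu : ∀ x ∈ u, b ≤ x) (hb : b ≠ 0) :
    ∀ y ∈ graft c s u, c + b ≤ y := by
  induction u generalizing s with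
  | nil => cases s <;> simp [graft]
  | cons x u ih =>
    have hx := hu x (by simp)
    have hu' : ∀ x ∈ u, b ≤ x := fun y hy => hu y (by simp [hy])
    cases s with
    | nil =>
      intro y hy
      rcases List.mem_cons.1 hy with rfl | hy
      · omega
      · exact ih hu' y hy
    | cons a s =>
      intro y hy
      rcases List.mem_cons.1 hy with rfl | hy
      · split_ifs <;> omega
      · exact ih hu' y hy

theorem pairwise_graft {c : ℕ} {s u : List ℕ} (hs : s.Pairwise (· ≤ ·)) (hsc : ∀ a ∈ s, a ≤ c)
    (hu : u.Pairwise (· ≤ ·)) : (graft c s u).Pairwise (· ≤ ·) := by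
  induction u generalizing s with
  | nil => cases s <;> simp [graft]
  | cons x u ih =>
    rw [List.pairwise_cons] at hu
    cases s with
    | nil =>
      rw [graft_nil_left]
      refine (List.pairwise_cons.2 hu).map _ fun a b h => ?_
      omega
    | cons a s =>
      rw [List.pairwise_cons] at hs
      refine List.pairwise_cons.2 ⟨?_, ih hs.2 (fun b hb => hsc b (by simp [hb])) hu.2⟩
      split_ifs with hx
      · exact le_of_mem_graft' hs.1 (hsc a (by simp))
      · exact add_le_of_mem_graft hu.1 hx

theorem graft_lt_graft {c : ℕ} {s u w : List ℕ} (hsc : ∀ a ∈ s, a ≤ c) (h : u < w) :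
    graft c s u < graft c s w := by
  induction u generalizing s w with
  | nil =>
    cases w with
    | nil => simp at h
    | cons y w => cases s <;> exact List.nil_lt_cons _ _
  | cons x u ih =>
    cases w with
    | nil => exact absurd h (by simp)
    | cons y w =>
      rw [List.cons_lt_cons_iff] at h
      cases s with
      | nil =>
        simp only [graft]
        rw [List.cons_lt_cons_iff]
        rcases h with h | ⟨rfl, h⟩
        · exact Or.inl (by omega)
        · exact Or.inr ⟨rfl, ih (by simp) h⟩
      | cons a s =>
        simp only [graft]
        rw [List.cons_lt_cons_iff]
        have ha := hsc a (by simp)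
        rcases h with h | ⟨rfl, h⟩
        · left; split_ifs <;> omega
        · exact Or.inr ⟨rfl, ih (fun b hb => hsc b (by simp [hb])) h⟩

theorem eq_replicate_of_getLastD_eq_zero {u : List ℕ} (hu : u.Pairwise (· ≤ ·))
    (h : u.getLastD 0 = 0) : u = List.replicate u.length 0 :=
  List.eq_replicate_iff.2 ⟨rfl, fun _ hx => Nat.le_zero.1 (h ▸ le_getLastD_of_mem hu hx)⟩

theorem getLastD_le_of_prefix {u w : List ℕ} (h : u <+: w) (hw : w.Pairwise (· ≤ ·)) :
    u.getLastD 0 ≤ w.getLastD 0 := by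
  by_cases hu : u = []
  · simp [hu]
  · exact le_getLastD_of_mem hw (h.subset (getLastD_mem hu))

theorem precKey_graft_lt {c : ℕ} {s u w : List ℕ} (hs : s.Pairwise (· ≤ ·))
    (hsc : ∀ a ∈ s, a ≤ c) (hu : u.Pairwise (· ≤ ·)) (hw : w.Pairwise (· ≤ ·))
    (h : precKey u < precKey w) : precKey (graft c s u) < precKey (graft c s w) := by
  rw [precKey_lt_iff] at h ⊢
  rcases h with h | ⟨h, hlt⟩
  · left
    rw [getLastD_graft (u := w) (by omega)]
    exact (getLastD_graft_le hsc hu).trans_lt (by omega)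
  · have hlt' := graft_lt_graft hsc hlt
    suffices (graft c s u).getLastD 0 ≤ (graft c s w).getLastD 0 from
      this.lt_or_eq.imp id fun h => ⟨h, hlt'⟩
    rcases eq_or_ne (w.getLastD 0) 0 with h0 | h0
    · have hu' := eq_replicate_of_getLastD_eq_zero hu (h.trans h0)
      have hw' := eq_replicate_of_getLastD_eq_zero hw h0
      have hpre : u <+: w := by
        rw [hu', hw'] at hlt
        rw [hu', hw']
        rcases le_total u.length w.length with hl | hl
        · exact ⟨List.replicate (w.length - u.length) 0, by
            rw [← List.replicate_add]; congr 1; omega⟩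
        · have hle : List.replicate w.length 0 <+: List.replicate u.length 0 :=
            ⟨List.replicate (u.length - w.length) 0, by
              rw [← List.replicate_add]; congr 1; omega⟩
          exact absurd hlt (List.IsPrefix.le hle)
      exact getLastD_le_of_prefix (graft_prefix c s hpre) (pairwise_graft hs hsc hw)
    · rw [getLastD_graft (u := w) h0, getLastD_graft (u := u) (by omega), h]

theorem finite_precKey_le {k : ℕ} (v : Om k) :
    {w : Om k | precKey w.1 ≤ precKey v.1}.Finite := by
  refine Set.Finite.of_finite_image (f := Subtype.val) ?_ Subtype.val_injective.injOn
  refine ((List.finite_length_eq (Fin (v.1.getLastD 0 + 1)) k).image (List.map Fin.val)).subset ?_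
  rintro _ ⟨w, hw, rfl⟩
  refine ⟨w.1.map (Fin.ofNat _), by simp [w.2.1], ?_⟩
  rw [List.map_map]
  refine (List.map_congr_left fun x hx => ?_).trans (List.map_id _)
  have hx' : x ≤ v.1.getLastD 0 :=
    (le_getLastD_of_mem w.2.2 hx).trans (getLastD_le_of_precKey_le hw)
  exact Nat.mod_eq_of_lt (Nat.lt_succ_of_le hx')

theorem exists_approx_eq {k : ℕ} {S : Set (Om k)} {v : Om k} (hv : v ∈ S) :
    ∃ n : ℕ, approx n S = {w | w ∈ S ∧ precKey w.1 ≤ precKey v.1} := by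
  have hfin : {w | w ∈ S ∧ precKey w.1 < precKey v.1}.Finite :=
    (finite_precKey_le v).subset fun w hw => hw.2.le
  refine ⟨{w | w ∈ S ∧ precKey w.1 < precKey v.1}.ncard + 1, ?_⟩
  ext w
  simp only [approx, prec_iff, Set.mem_ofPred_eq]
  refine and_congr_right fun hw => ?_
  rw [Nat.cast_add, hfin.cast_ncard_eq, Nat.cast_one, ENat.lt_add_one_iff (by simpa using hfin)]
  constructor
  · intro h
    by_contra hlt
    rw [not_le] at hlt
    refine absurd h (not_le.2 (hfin.encard_lt_encard ?_))
    refine (Set.ssubset_iff_of_subset ?_).2 ⟨v, ⟨hv, hlt⟩, fun h => lt_irrefl _ h.2⟩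
    exact fun x hx => ⟨hx.1, hx.2.trans hlt⟩
  · exact fun h => Set.encard_le_encard fun x hx => ⟨hx.1, hx.2.trans_le h⟩

theorem getLastD_diagSeq {k : ℕ} (s : OmLE k) (hs : s.1.length < k) (i : ℕ) :
    (diagSeq s i).1.getLastD 0 = s.1.getLastD 0 + i := by
  obtain ⟨n, hn⟩ := Nat.exists_eq_add_of_lt hs
  have : k - s.1.length = n + 1 := by omega
  simp only [diagSeq, this, List.replicate_succ', ← List.append_assoc, getLastD_append_singleton]

theorem precKey_diagSeq_lt_iff {k : ℕ} (s : OmLE k) (hs : s.1.length < k) {i j : ℕ} :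
    precKey (diagSeq s i).1 < precKey (diagSeq s j).1 ↔ i < j := by
  have key : ∀ i j, i < j → precKey (diagSeq s i).1 < precKey (diagSeq s j).1 := fun i j h =>
    precKey_lt_iff.2 (Or.inl (by rw [getLastD_diagSeq s hs, getLastD_diagSeq s hs]; omega))
  refine ⟨fun h => ?_, key i j⟩
  by_contra h'
  rcases (not_lt.1 h').eq_or_lt with rfl | h'
  · exact lt_irrefl _ h
  · exact lt_asymm h (key _ _ h')

theorem precKey_diagSeq_le_iff {k : ℕ} (s : OmLE k) (hs : s.1.length < k) {i j : ℕ} :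
    precKey (diagSeq s i).1 ≤ precKey (diagSeq s j).1 ↔ i ≤ j := by
  rw [← not_lt, precKey_diagSeq_lt_iff s hs, not_lt]

theorem diagSeq_injective {k : ℕ} (s : OmLE k) (hs : s.1.length < k) :
    Function.Injective (diagSeq s) := fun i j h =>
  le_antisymm ((precKey_diagSeq_le_iff s hs).1 (by rw [h]))
    ((precKey_diagSeq_le_iff s hs).1 (by rw [h]))

/-- Between two diagonal sequences there is a member of `AR k` which contains exactly the diagonal
sequences between them. -/
theorem exists_mem_AR_diagSeq {k : ℕ} (s : OmLE k) (hs : s.1.length < k) {a b : ℕ} (hab : a ≤ b) :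
    ∃ E ∈ AR k, (∀ i, diagSeq s i ∈ E ↔ a ≤ i ∧ i ≤ b) ∧
      ∀ v ∈ E, precKey (diagSeq s a).1 ≤ precKey v.1 ∧ precKey v.1 ≤ precKey (diagSeq s b).1 := by
  set c := s.1.getLastD 0 + a with hc
  have hsc : ∀ x ∈ s.1, x ≤ c := fun x hx => (le_getLastD_of_mem s.2.2 hx).trans (by omega)
  let X : OmLE k → OmLE k := fun u => ⟨graft c s.1 u.1, by rw [length_graft]; exact u.2.1,
    pairwise_graft s.2.2 hsc u.2.2⟩
  have hX : IsTree X := by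
    refine ⟨fun u w h => ?_, fun u w h => ⟨graft_prefix c _ h.1, ?_⟩⟩
    · rw [prec_iff] at h ⊢
      exact precKey_graft_lt s.2.2 hsc u.2.2 w.2.2 h
    · simpa only [X, length_graft] using h.2
  have hmem : ∀ j, diagSeq s (a + j) ∈ topRange X := fun j => by
    refine ⟨⟨List.replicate s.1.length 0 ++ List.replicate (k - s.1.length) j, by simp; omega, ?_⟩,
      Subtype.ext ?_⟩
    · rw [List.pairwise_append]
      refine ⟨List.pairwise_replicate.2 (Or.inr le_rfl),
        List.pairwise_replicate.2 (Or.inr le_rfl), fun x hx y _ => ?_⟩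
      rw [(List.mem_replicate.1 hx).2]; exact Nat.zero_le _
    · simp only [X, Om.toOmLE, graft_replicate_append, diagSeq, List.map_replicate]
      rw [hc, add_assoc]
  have hmin : ∀ v ∈ topRange X, precKey (diagSeq s a).1 ≤ precKey v.1 := by
    rintro v ⟨u, hu⟩
    have hv : v.1 = graft c s.1 u.1 := (congrArg Subtype.val hu).symm
    have h0 : (diagSeq s a).1 = graft c s.1 (List.replicate k 0) := by
      have : List.replicate k 0 =
          List.replicate s.1.length 0 ++ List.replicate (k - s.1.length) 0 := by
        rw [← List.replicate_add]; congr 1; omega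
      rw [this, graft_replicate_append]
      simp [diagSeq, hc]
    rw [hv, h0]
    have hle : precKey (List.replicate k 0) ≤ precKey u.1 := by
      by_contra hlt
      rw [not_le] at hlt
      have h1 := getLastD_le_of_precKey_le hlt.le
      have h2 : (List.replicate k 0).getLastD 0 = 0 := by cases k <;> simp [List.replicate_succ']
      rw [eq_replicate_of_getLastD_eq_zero u.2.2 (by omega), u.2.1] at hlt
      exact lt_irrefl _ hlt
    rcases hle.eq_or_lt with h | h
    · rw [precKey_injective h]
    · exact (precKey_graft_lt s.2.2 hsc (List.pairwise_replicate.2 (Or.inr le_rfl)) u.2.2 h).le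
  have hb : diagSeq s b ∈ topRange X := by
    simpa only [Nat.add_sub_cancel' hab] using hmem (b - a)
  obtain ⟨n, hn⟩ := exists_approx_eq hb
  refine ⟨_, ⟨X, hX, n, rfl⟩, fun i => ?_, fun v hv => ?_⟩
  · rw [hn]
    constructor
    · rintro ⟨h1, h2⟩
      exact ⟨(precKey_diagSeq_le_iff s hs).1 (hmin _ h1), (precKey_diagSeq_le_iff s hs).1 h2⟩
    · rintro ⟨h1, h2⟩
      refine ⟨?_, (precKey_diagSeq_le_iff s hs).2 h2⟩
      simpa only [Nat.add_sub_cancel' h1] using hmem (i - a)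
  · rw [hn] at hv
    exact ⟨hmin v hv.1, hv.2⟩

section Level

variable {k d : ℕ} {θ : ℝ}

theorem level_mono_abs (h0 : 0 < θ) (h1 : θ < 1) (j : ℕ) {x y : Om k →₀ ℝ}
    (h : ∀ v, |x v| ≤ |y v|) : level k d θ j x ≤ level k d θ j y := by
  induction j generalizing x y with
  | zero => exact ciSup_mono (bddAbove_level_zero y) h
  | succ j ih =>
    refine max_le_max (ih h) (mul_le_mul_of_nonneg_left ?_ h0.le)
    refine Real.sSup_le ?_ (sSup_admissible_nonneg j y)
    rintro r ⟨m, hm1, hmd, E, hE, rfl⟩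
    refine le_trans (Finset.sum_le_sum fun i _ => ih fun v => ?_)
      (le_csSup (bddAbove_admissible h0 h1 j y) ⟨m, hm1, hmd, E, hE, rfl⟩)
    classical
    rw [restrict_apply, restrict_apply]
    split_ifs
    · exact h v
    · exact le_rfl

theorem tnorm_mono_abs (h0 : 0 < θ) (h1 : θ < 1) {x y : Om k →₀ ℝ}
    (h : ∀ v, |x v| ≤ |y v|) : tnorm k d θ x ≤ tnorm k d θ y :=
  ciSup_mono (bddAbove_level h0 h1 y) fun j => level_mono_abs h0 h1 j h

theorem tendsto_level (h0 : 0 < θ) (h1 : θ < 1) (x : Om k →₀ ℝ) :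
    Filter.Tendsto (fun j => level k d θ j x) Filter.atTop (nhds (tnorm k d θ x)) :=
  tendsto_atTop_ciSup (monotone_nat_of_le_succ fun _ => le_max_left _ _) (bddAbove_level h0 h1 x)

theorem sum_tnorm_restrict_le (h0 : 0 < θ) (h1 : θ < 1) {m : ℕ} (hm1 : 1 ≤ m) (hmd : m ≤ d)
    {E : Fin m → Set (Om k)} (hE : Admissible E) (x : Om k →₀ ℝ) :
    θ * ∑ i, tnorm k d θ (restrict (E i) x) ≤ tnorm k d θ x := by
  refine le_of_tendsto'
    ((tendsto_finsetSum Finset.univ fun i _ => tendsto_level h0 h1 (restrict (E i) x)).const_mul θ)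
    fun j => ?_
  refine le_trans ?_ (le_ciSup (bddAbove_level h0 h1 x) (j + 1))
  refine le_max_of_le_right (mul_le_mul_of_nonneg_left ?_ h0.le)
  exact le_csSup (bddAbove_admissible h0 h1 j x) ⟨m, hm1, hmd, E, hE, rfl⟩

theorem rpow_mul_rpow_eq_one (hd : 1 ≤ d) (h0 : 0 < θ) {p : ℝ} (hp1 : 1 < p)
    (hp : (d : ℝ) * θ = (d : ℝ) ^ (1 / p)) : θ ^ p * (d : ℝ) ^ (p - 1) = 1 := by
  have hd0 : (0 : ℝ) < d := by exact_mod_cast hd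
  have h := congrArg (· ^ p) hp
  rw [Real.mul_rpow hd0.le h0.le, ← Real.rpow_mul hd0.le, one_div_mul_cancel (by linarith),
    Real.rpow_one] at h
  rw [Real.rpow_sub_one hd0.ne', ← mul_div_assoc, mul_comm, h, div_self hd0.ne']

theorem sum_abs_restrict_rpow_le {m : ℕ} {E : Fin m → Set (Om k)} (hE : Admissible E)
    {p : ℝ} (hp : 0 < p) (x : Om k →₀ ℝ) (v : Om k) :
    ∑ i, |restrict (E i) x v| ^ p ≤ |x v| ^ p := by
  classical
  by_cases h : ∃ i, v ∈ E i
  · obtain ⟨i, hi⟩ := h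
    rw [Finset.sum_eq_single i]
    · simp [restrict_apply, hi]
    · intro j _ hji
      have hj : v ∉ E j := by
        intro hj
        rcases lt_or_gt_of_ne hji with h | h
        · exact prec_irrefl _ (hE.2 j i h v hj v hi)
        · exact prec_irrefl _ (hE.2 i j h v hi v hj)
      simp [restrict_apply, hj, Real.zero_rpow hp.ne']
    · simp
  · push Not at h
    simp only [restrict_apply, h, if_false, abs_zero, Real.zero_rpow hp.ne',
      Finset.sum_const_zero]
    positivity

theorem level_le_rpow_sum (hd : 1 ≤ d) (h0 : 0 < θ) {p : ℝ} (hp1 : 1 < p)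
    (hp : (d : ℝ) * θ = (d : ℝ) ^ (1 / p)) (j : ℕ) {A : Finset (Om k)} {x : Om k →₀ ℝ}
    (hx : x.support ⊆ A) : level k d θ j x ≤ (∑ v ∈ A, |x v| ^ p) ^ (1 / p) := by
  have hp0 : 0 < p := by linarith
  induction j generalizing x with
  | zero =>
    refine Real.iSup_le (fun v => ?_) (by positivity)
    by_cases hv : v ∈ A
    · calc |x v| = (|x v| ^ p) ^ (1 / p) := by
            rw [← Real.rpow_mul (abs_nonneg _), mul_one_div_cancel hp0.ne', Real.rpow_one]
        _ ≤ _ := by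
            refine Real.rpow_le_rpow (by positivity) ?_ (by positivity)
            exact Finset.single_le_sum (f := fun v => |x v| ^ p) (fun _ _ => by positivity) hv
    · rw [Finsupp.notMem_support_iff.1 fun h => hv (hx h), abs_zero]
      positivity
  | succ j ih =>
    refine max_le (ih hx) ?_
    rw [mul_comm, ← le_div_iff₀ h0]
    refine Real.sSup_le ?_ (by positivity)
    rintro r ⟨m, _, hmd, E, hE, rfl⟩
    rw [le_div_iff₀ h0]
    have hb : ∀ i, level k d θ j (restrict (E i) x) ^ p ≤ ∑ v ∈ A, |restrict (E i) x v| ^ p := by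
      intro i
      have hsub : (restrict (E i) x).support ⊆ A := by
        classical exact (Finset.filter_subset _ _).trans hx
      calc _ ≤ ((∑ v ∈ A, |restrict (E i) x v| ^ p) ^ (1 / p)) ^ p :=
            Real.rpow_le_rpow (level_nonneg j _) (ih hsub) hp0.le
        _ = _ := by
            rw [← Real.rpow_mul (by positivity), one_div_mul_cancel hp0.ne', Real.rpow_one]
    have hsum0 : 0 ≤ ∑ i, level k d θ j (restrict (E i) x) :=
      Finset.sum_nonneg fun i _ => level_nonneg j _
    rw [one_div, Real.le_rpow_inv_iff_of_pos (by positivity) (by positivity) hp0,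
      Real.mul_rpow hsum0 h0.le]
    calc (∑ i, level k d θ j (restrict (E i) x)) ^ p * θ ^ p
        ≤ ((m : ℝ) ^ (p - 1) * ∑ i, level k d θ j (restrict (E i) x) ^ p) * θ ^ p := by
          gcongr
          simpa using Real.rpow_sum_le_const_mul_sum_rpow_of_nonneg (s := Finset.univ) hp1.le
            fun i _ => level_nonneg (d := d) (θ := θ) j (restrict (E i) x)
      _ ≤ ((d : ℝ) ^ (p - 1) * ∑ v ∈ A, |x v| ^ p) * θ ^ p := by
          refine mul_le_mul_of_nonneg_right (mul_le_mul ?_ ?_ ?_ (by positivity)) (by positivity)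
          · exact Real.rpow_le_rpow (by positivity) (by exact_mod_cast hmd) (by linarith)
          · calc _ ≤ ∑ i, ∑ v ∈ A, |restrict (E i) x v| ^ p := Finset.sum_le_sum fun i _ => hb i
              _ = ∑ v ∈ A, ∑ i, |restrict (E i) x v| ^ p := Finset.sum_comm
              _ ≤ _ := Finset.sum_le_sum fun v _ => sum_abs_restrict_rpow_le hE hp0 x v
          · exact Finset.sum_nonneg fun i _ => Real.rpow_nonneg (level_nonneg j _) _
      _ = (θ ^ p * (d : ℝ) ^ (p - 1)) * ∑ v ∈ A, |x v| ^ p := by ring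
      _ = _ := by rw [rpow_mul_rpow_eq_one hd h0 hp1 hp, one_mul]

end Level

section Kraft

/-- An order-preserving version of Kraft's inequality, for a set function which is superadditive
up to the factor `θ` over at most `d` successive sets: well separated points `t i` have
`d`-adic codes of the lengths `m i`. -/
theorem sum_pow_mul_le_of_separated {d : ℕ} (hd : 1 ≤ d) {θ : ℝ} (h0 : 0 < θ)
    {Φ : Finset ℕ → ℝ} {y : ℕ → ℝ} (hΦ0 : 0 ≤ Φ ∅) (hΦ1 : ∀ i, y i ≤ Φ {i})
    (hΦ : ∀ (G : Fin d → Finset ℕ) (U : Finset ℕ), (∀ r, G r ⊆ U) →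
      (∀ r r', r < r' → ∀ i ∈ G r, ∀ j ∈ G r', i < j) → θ * ∑ r, Φ (G r) ≤ Φ U)
    {F : Finset ℕ} {t : ℕ → ℝ} {m : ℕ → ℕ} (ht0 : ∀ i ∈ F, 0 ≤ t i) (ht1 : ∀ i ∈ F, t i < 1)
    (ht : ∀ i ∈ F, ∀ j ∈ F, i < j → (1 / d : ℝ) ^ m i + (1 / d : ℝ) ^ m j ≤ t j - t i) :
    ∑ i ∈ F, θ ^ m i * y i ≤ Φ F := by
  have hd0 : (0 : ℝ) < d := by exact_mod_cast hd
  have hd1 : (1 / d : ℝ) ≤ 1 := by rw [div_le_one hd0]; exact_mod_cast hd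
  have hmono : ∀ i ∈ F, ∀ j ∈ F, t i < t j → i < j := by
    intro i hi j hj h
    by_contra h'
    rcases (not_lt.1 h').eq_or_lt with rfl | h'
    · exact lt_irrefl _ h
    · have := ht j hj i hi h'
      have h1 : 0 < (1 / d : ℝ) ^ m i := by positivity
      have h2 : 0 < (1 / d : ℝ) ^ m j := by positivity
      linarith
  have hsep : ∀ i ∈ F, ∀ j ∈ F, i ≠ j → (1 / d : ℝ) ^ m i ≤ |t i - t j| := by
    intro i hi j hj hij
    have h1 : 0 < (1 / d : ℝ) ^ m i := by positivity
    have h2 : 0 < (1 / d : ℝ) ^ m j := by positivity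
    rcases lt_or_gt_of_ne hij with h | h
    · rw [abs_sub_comm]
      exact le_trans (by linarith [ht i hi j hj h]) (le_abs_self _)
    · exact le_trans (by linarith [ht j hj i hi h]) (le_abs_self _)
  have hleaf : ∀ n c i, i ∈ F → ⌊t i * d ^ n⌋₊ = c → m i ≤ n →
      ∑ i ∈ F with ⌊t i * d ^ n⌋₊ = c, θ ^ (m i - n) * y i ≤ Φ {i ∈ F | ⌊t i * d ^ n⌋₊ = c} := by
    intro n c i hiF hic hin
    set G := {i ∈ F | ⌊t i * d ^ n⌋₊ = c} with hG
    have hi : i ∈ G := Finset.mem_filter.2 ⟨hiF, hic⟩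
    have hGi : G = {i} := by
      refine Finset.eq_singleton_iff_unique_mem.2 ⟨hi, fun j hj => ?_⟩
      by_contra hji
      rw [hG, Finset.mem_filter] at hi hj
      have h1 := hsep i hi.1 j hj.1 (Ne.symm hji)
      have h2 : (1 / d : ℝ) ^ n ≤ (1 / d : ℝ) ^ m i :=
        pow_le_pow_of_le_one (by positivity) hd1 hin
      have hdn : (0 : ℝ) < d ^ n := by positivity
      have a1 := Nat.floor_le (mul_nonneg (ht0 i hi.1) hdn.le)
      have a2 := Nat.lt_floor_add_one (t i * d ^ n)
      have b1 := Nat.floor_le (mul_nonneg (ht0 j hj.1) hdn.le)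
      have b2 := Nat.lt_floor_add_one (t j * d ^ n)
      rw [hi.2] at a1 a2
      rw [hj.2] at b1 b2
      have h3 : |t i - t j| * d ^ n < 1 := by
        have h4 : |t i - t j| * d ^ n = |(t i - t j) * d ^ n| := by rw [abs_mul, abs_of_pos hdn]
        rw [h4, abs_lt, sub_mul]
        constructor <;> linarith
      rw [← lt_div_iff₀ hdn, ← one_div_pow] at h3
      linarith
    rw [hGi, Finset.sum_singleton, Nat.sub_eq_zero_of_le hin, pow_zero, one_mul]
    exact hΦ1 i
  have key : ∀ N n, (∀ i ∈ F, m i ≤ n + N) → ∀ c : ℕ,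
      ∑ i ∈ F with ⌊t i * d ^ n⌋₊ = c, θ ^ (m i - n) * y i ≤ Φ {i ∈ F | ⌊t i * d ^ n⌋₊ = c} := by
    intro N
    induction N with
    | zero =>
      intro n hN c
      by_cases h : ∃ i ∈ F, ⌊t i * d ^ n⌋₊ = c
      · obtain ⟨i, hi, hic⟩ := h
        exact hleaf n c i hi hic (hN i hi)
      · push Not at h
        rw [Finset.filter_false_of_mem h, Finset.sum_empty]
        exact hΦ0
    | succ N ih =>
      intro n hN c
      by_cases h : ∃ i ∈ F, ⌊t i * d ^ n⌋₊ = c ∧ m i ≤ n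
      · obtain ⟨i, hi, hic, hin⟩ := h
        exact hleaf n c i hi hic hin
      push Not at h
      set G := {i ∈ F | ⌊t i * d ^ n⌋₊ = c} with hG
      have hfl : ∀ i, ⌊t i * d ^ n⌋₊ = ⌊t i * d ^ (n + 1)⌋₊ / d := by
        intro i
        rw [← Nat.floor_div_natCast, pow_succ, ← mul_assoc, mul_div_cancel_right₀ _ hd0.ne']
      let g : ℕ → Fin d := fun i => ⟨⌊t i * d ^ (n + 1)⌋₊ % d, Nat.mod_lt _ hd⟩
      have hGr : ∀ r : Fin d, {i ∈ G | g i = r} =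
          {i ∈ F | ⌊t i * d ^ (n + 1)⌋₊ = c * d + r} := by
        intro r
        ext i
        simp only [hG, Finset.mem_filter, and_assoc, g, hfl, Fin.ext_iff]
        refine and_congr_right fun _ => ⟨?_, fun h => ?_⟩
        · rintro ⟨h1, h2⟩
          rw [← h1, ← h2, Nat.div_add_mod']
        · rw [h]
          constructor
          · rw [mul_comm, Nat.mul_add_div hd, Nat.div_eq_of_lt r.2, add_zero]
          · rw [mul_comm, Nat.mul_add_mod, Nat.mod_eq_of_lt r.2]
      calc ∑ i ∈ G, θ ^ (m i - n) * y i
          = θ * ∑ r, ∑ i ∈ G with g i = r, θ ^ (m i - (n + 1)) * y i := by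
            rw [Finset.sum_fiberwise, Finset.mul_sum]
            refine Finset.sum_congr rfl fun i hi => ?_
            rw [← mul_assoc, ← pow_succ']
            congr 2
            have := h i (Finset.mem_filter.1 hi).1 (Finset.mem_filter.1 hi).2
            omega
        _ ≤ θ * ∑ r, Φ {i ∈ G | g i = r} := by
            refine mul_le_mul_of_nonneg_left (Finset.sum_le_sum fun r _ => ?_) h0.le
            rw [hGr]
            exact ih (n + 1) (fun i hi => (hN i hi).trans (by omega)) _
        _ ≤ Φ G := by
            refine hΦ _ _ (fun r => Finset.filter_subset _ _) fun r r' hr i hi j hj => ?_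
            rw [hGr, Finset.mem_filter] at hi hj
            refine hmono i hi.1 j hj.1 ?_
            have hlt : ⌊t i * d ^ (n + 1)⌋₊ < ⌊t j * d ^ (n + 1)⌋₊ := by
              rw [hi.2, hj.2]
              exact Nat.add_lt_add_left hr _
            by_contra hle
            refine absurd hlt (not_lt.2 (Nat.floor_le_floor ?_))
            exact mul_le_mul_of_nonneg_right (not_lt.1 hle) (by positivity)
  have hF : {i ∈ F | ⌊t i * (d : ℝ) ^ 0⌋₊ = 0} = F := by
    refine Finset.filter_true_of_mem fun i hi => ?_
    rw [pow_zero, mul_one, Nat.floor_eq_zero]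
    exact ht1 i hi
  have := key (F.sup m) 0 (fun i hi => by simpa using Finset.le_sup (f := m) hi) 0
  rw [hF] at this
  simpa using this

/-- A set function which is superadditive up to the factor `θ = d ^ (1 / p - 1)` over at most `d`
successive sets satisfies a lower `p`-estimate. -/
theorem rpow_sum_le_of_superadditive {d : ℕ} (hd : 2 ≤ d) {θ : ℝ} (h0 : 0 < θ) {p : ℝ}
    (hp1 : 1 < p) (hp : (d : ℝ) * θ = (d : ℝ) ^ (1 / p))
    {Φ : Finset ℕ → ℝ} {y : ℕ → ℝ} (hΦ0 : 0 ≤ Φ ∅) (hΦ1 : ∀ i, y i ≤ Φ {i})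
    (hΦ : ∀ (G : Fin d → Finset ℕ) (U : Finset ℕ), (∀ r, G r ⊆ U) →
      (∀ r r', r < r' → ∀ i ∈ G r, ∀ j ∈ G r', i < j) → θ * ∑ r, Φ (G r) ≤ Φ U)
    {F : Finset ℕ} (hF : F.Nonempty) (hy : ∀ i ∈ F, 0 < y i) :
    (1 / (2 * d) : ℝ) ^ (1 - 1 / p) * (∑ i ∈ F, y i ^ p) ^ (1 / p) ≤ Φ F := by
  have hp0 : 0 < p := by linarith
  have hd2 : (2 : ℝ) ≤ d := by exact_mod_cast hd
  have hd0 : (0 : ℝ) < d := by linarith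
  have hβ : 0 ≤ 1 - 1 / p := by
    rw [sub_nonneg, div_le_one hp0]; exact hp1.le
  have hθ : θ = (1 / d : ℝ) ^ (1 - 1 / p) := by
    rw [one_div (d : ℝ), Real.inv_rpow hd0.le, ← Real.rpow_neg hd0.le, neg_sub,
      Real.rpow_sub_one hd0.ne', ← hp, mul_div_cancel_left₀ _ hd0.ne']
  set S := ∑ i ∈ F, y i ^ p with hS
  have hSpos : 0 < S := Finset.sum_pos (fun i hi => Real.rpow_pos_of_pos (hy i hi) p) hF
  let w : ℕ → ℝ := fun i => y i ^ p / S
  have hw0 : ∀ i ∈ F, 0 < w i := fun i hi => div_pos (Real.rpow_pos_of_pos (hy i hi) p) hSpos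
  have hw1 : ∑ i ∈ F, w i = 1 := by rw [← Finset.sum_div, div_self hSpos.ne']
  have hwle : ∀ i ∈ F, w i ≤ 1 := fun i hi =>
    hw1 ▸ Finset.single_le_sum (fun j hj => (hw0 j hj).le) hi
  have hm : ∀ i, ∃ m : ℕ, i ∈ F → (1 / d : ℝ) ^ m ≤ w i / 2 ∧
      1 / (2 * d) * w i ≤ (1 / d : ℝ) ^ m := by
    intro i
    by_cases hi : i ∈ F
    · obtain ⟨n, h1, h2⟩ := exists_nat_pow_near_of_lt_one (x := w i / 2) (y := (1 / d : ℝ))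
        (half_pos (hw0 i hi)) (by linarith [hwle i hi]) (by positivity)
        (by rw [div_lt_one hd0]; linarith)
      refine ⟨n + 1, fun _ => ⟨h1.le, ?_⟩⟩
      calc 1 / (2 * d) * w i = w i / 2 * (1 / d) := by field_simp
        _ ≤ (1 / d : ℝ) ^ n * (1 / d) := by gcongr
        _ = _ := (pow_succ _ _).symm
    · exact ⟨0, fun h => absurd h hi⟩
  choose m hm using hm
  let t : ℕ → ℝ := fun i => ∑ j ∈ F with j < i, w j + w i / 2
  have hinsert : ∀ i ∈ F, ∀ A ⊆ F, i ∈ A → (∀ j ∈ F, j < i → j ∈ A) →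
      ∑ j ∈ F with j < i, w j + w i ≤ ∑ j ∈ A, w j := by
    intro i hi A hA hiA h
    rw [add_comm, ← Finset.sum_insert (by simp)]
    refine Finset.sum_le_sum_of_subset_of_nonneg ?_ fun j hj _ => (hw0 j (hA hj)).le
    intro j hj
    rcases Finset.mem_insert.1 hj with rfl | hj
    · exact hiA
    · exact h j (Finset.mem_filter.1 hj).1 (Finset.mem_filter.1 hj).2
  have hle := sum_pow_mul_le_of_separated (by omega) h0 hΦ0 hΦ1 hΦ (F := F) (t := t) (m := m)
    (fun i hi => add_nonneg (Finset.sum_nonneg fun j hj => (hw0 j (Finset.mem_filter.1 hj).1).le)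
      (half_pos (hw0 i hi)).le)
    (fun i hi => by
      have h1 := hinsert i hi F subset_rfl hi fun j hj _ => hj
      have h2 := hw0 i hi
      simp only [t]
      linarith)
    (fun i hi j hj hij => by
      have h1 := hinsert i hi {l ∈ F | l < j} (Finset.filter_subset _ _)
        (Finset.mem_filter.2 ⟨hi, hij⟩) fun l hl h => Finset.mem_filter.2 ⟨hl, h.trans hij⟩
      have h2 := (hm i hi).1
      have h3 := (hm j hj).1
      simp only [t]
      linarith)
  refine le_trans ?_ hle
  have hterm : ∀ i ∈ F,
      (1 / (2 * d) : ℝ) ^ (1 - 1 / p) * (y i ^ p / S ^ (1 - 1 / p)) ≤ θ ^ m i * y i := by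
    intro i hi
    have hyi := hy i hi
    have h1 : (1 / (2 * d) : ℝ) ^ (1 - 1 / p) * w i ^ (1 - 1 / p) ≤ θ ^ m i := by
      rw [hθ, ← Real.mul_rpow (by positivity) (hw0 i hi).le, ← Real.rpow_mul_natCast (by positivity),
        mul_comm (1 - 1 / p), Real.rpow_natCast_mul (by positivity)]
      exact Real.rpow_le_rpow (mul_nonneg (by positivity) (hw0 i hi).le) (hm i hi).2 hβ
    have h2 : w i ^ (1 - 1 / p) * y i = y i ^ p / S ^ (1 - 1 / p) := by
      simp only [w]
      rw [Real.div_rpow (by positivity) hSpos.le, ← Real.rpow_mul hyi.le, mul_sub, mul_one,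
        mul_one_div_cancel hp0.ne', Real.rpow_sub_one hyi.ne']
      field_simp
    rw [← h2, ← mul_assoc]
    exact mul_le_mul_of_nonneg_right h1 hyi.le
  refine le_trans (le_of_eq ?_) (Finset.sum_le_sum hterm)
  rw [← Finset.mul_sum, ← Finset.sum_div, ← hS]
  congr 1
  rw [eq_div_iff (by positivity), ← Real.rpow_add hSpos, add_sub_cancel, Real.rpow_one]

end Kraft

section Diagonal

variable {k d : ℕ} {θ : ℝ}

/-- The vector with the coordinates `a i`, `i ∈ F`, on the diagonal above `s`. -/
noncomputable def diagVec (s : OmLE k) (a : ℕ → ℝ) (F : Finset ℕ) : Om k →₀ ℝ :=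
  ∑ i ∈ F, Finsupp.single (diagSeq s i) (a i)

theorem diagVec_diagSeq {s : OmLE k} (hs : s.1.length < k) (a : ℕ → ℝ) (F : Finset ℕ) (i : ℕ) :
    diagVec s a F (diagSeq s i) = if i ∈ F then a i else 0 := by
  classical
  simp [diagVec, Finsupp.finsetSum_apply, Finsupp.single_apply, (diagSeq_injective s hs).eq_iff]

theorem support_diagVec_subset [DecidableEq (Om k)] (s : OmLE k) (a : ℕ → ℝ) (F : Finset ℕ) :
    (diagVec s a F).support ⊆ F.image (diagSeq s) := by
  refine Finsupp.support_finsetSum.trans fun v hv => ?_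
  obtain ⟨i, hi, hv⟩ := Finset.mem_biUnion.1 hv
  exact Finset.mem_image.2 ⟨i, hi, (Finset.mem_singleton.1 (Finsupp.support_single_subset hv)).symm⟩

theorem tnorm_diagVec_le (hd : 1 ≤ d) (h0 : 0 < θ) {p : ℝ} (hp1 : 1 < p)
    (hp : (d : ℝ) * θ = (d : ℝ) ^ (1 / p)) {s : OmLE k} (hs : s.1.length < k) (a : ℕ → ℝ)
    (F : Finset ℕ) : tnorm k d θ (diagVec s a F) ≤ (∑ i ∈ F, |a i| ^ p) ^ (1 / p) := by
  classical
  refine Real.iSup_le (fun j => ?_) (by positivity)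
  refine (level_le_rpow_sum hd h0 hp1 hp j (support_diagVec_subset s a F)).trans (le_of_eq ?_)
  rw [Finset.sum_image (diagSeq_injective s hs).injOn]
  congr 1
  refine Finset.sum_congr rfl fun i hi => ?_
  rw [diagVec_diagSeq hs, if_pos hi]

theorem sum_tnorm_diagVec_le (h0 : 0 < θ) (h1 : θ < 1) {s : OmLE k} (hs : s.1.length < k)
    (a : ℕ → ℝ) (G : Fin d → Finset ℕ) (U : Finset ℕ) (hU : ∀ r, G r ⊆ U)
    (hG : ∀ r r', r < r' → ∀ i ∈ G r, ∀ j ∈ G r', i < j) :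
    θ * ∑ r, tnorm k d θ (diagVec s a (G r)) ≤ tnorm k d θ (diagVec s a U) := by
  classical
  set R : Finset (Fin d) := {r | (G r).Nonempty} with hR
  have hsum : ∑ r, tnorm k d θ (diagVec s a (G r)) =
      ∑ i, tnorm k d θ (diagVec s a (G (R.orderEmbOfFin rfl i))) := by
    rw [← Finset.sum_subset (Finset.subset_univ R), ← Finset.sum_coe_sort R]
    · exact (Equiv.sum_comp (R.orderIsoOfFin rfl).toEquiv _).symm
    · intro r _ hr
      have : G r = ∅ := by simpa [hR] using hr
      rw [this, diagVec, Finset.sum_empty]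
      exact (tnorm_eq_zero_iff h0 h1 _).2 rfl
  rw [hsum]
  rcases Nat.eq_zero_or_pos R.card with hR0 | hRpos
  · have : IsEmpty (Fin R.card) := by rw [hR0]; infer_instance
    rw [Finset.univ_eq_empty, Finset.sum_empty, mul_zero]
    exact tnorm_nonneg _
  have hne : ∀ i, (G (R.orderEmbOfFin rfl i)).Nonempty := fun i =>
    (Finset.mem_filter.1 (R.orderEmbOfFin_mem rfl i)).2
  choose E hEAR hE hEb using fun i => exists_mem_AR_diagSeq s hs
    ((G (R.orderEmbOfFin rfl i)).min'_le_max' (hne i))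
  have hmem : ∀ i, ∀ j ∈ G (R.orderEmbOfFin rfl i), diagSeq s j ∈ E i := fun i j hj =>
    (hE i j).2 ⟨Finset.min'_le _ _ hj, Finset.le_max' _ _ hj⟩
  have hadm : Admissible E := by
    refine ⟨fun i => ⟨hEAR i, _, hmem i _ (hne i).choose_spec⟩, fun i j hij v hv w hw => ?_⟩
    rw [prec_iff]
    refine (hEb i v hv).2.trans_lt (lt_of_lt_of_le ?_ (hEb j w hw).1)
    rw [precKey_diagSeq_lt_iff s hs]
    exact hG _ _ ((R.orderEmbOfFin rfl).strictMono hij) _ (Finset.max'_mem _ _) _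
      (Finset.min'_mem _ _)
  refine le_trans (mul_le_mul_of_nonneg_left (Finset.sum_le_sum fun i _ => ?_) h0.le)
    (sum_tnorm_restrict_le h0 h1 hRpos (by simpa using R.card_le_univ) hadm _)
  refine tnorm_mono_abs h0 h1 fun v => ?_
  by_cases hv : v ∈ (G (R.orderEmbOfFin rfl i)).image (diagSeq s)
  · obtain ⟨j, hj, rfl⟩ := Finset.mem_image.1 hv
    rw [restrict_apply, if_pos (hmem i j hj), diagVec_diagSeq hs, diagVec_diagSeq hs, if_pos hj,
      if_pos (hU _ hj)]
  · rw [Finsupp.notMem_support_iff.1 fun h => hv (support_diagVec_subset s a _ h), abs_zero]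
    exact abs_nonneg _

theorem le_tnorm_diagVec (hd : 2 ≤ d) (h0 : 0 < θ) (h1 : θ < 1) {p : ℝ} (hp1 : 1 < p)
    (hp : (d : ℝ) * θ = (d : ℝ) ^ (1 / p)) {s : OmLE k} (hs : s.1.length < k) (a : ℕ → ℝ)
    (F : Finset ℕ) : (1 / (2 * d) : ℝ) ^ (1 - 1 / p) * (∑ i ∈ F, |a i| ^ p) ^ (1 / p) ≤
      tnorm k d θ (diagVec s a F) := by
  have hp0 : 0 < p := by linarith
  have hsum : ∑ i ∈ F, |a i| ^ p = ∑ i ∈ F with a i ≠ 0, |a i| ^ p :=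
    (Finset.sum_filter_of_ne (p := fun i => a i ≠ 0) fun i _ h ha =>
      h (by rw [ha, abs_zero, Real.zero_rpow hp0.ne'])).symm
  have hvec : diagVec s a F = diagVec s a {i ∈ F | a i ≠ 0} :=
    (Finset.sum_filter_of_ne (p := fun i => a i ≠ 0) fun i _ h ha =>
      h (by rw [ha, Finsupp.single_zero])).symm
  rw [hsum, hvec]
  rcases Finset.eq_empty_or_nonempty {i ∈ F | a i ≠ 0} with h | h
  · rw [h, Finset.sum_empty, Real.zero_rpow (by positivity), mul_zero]
    exact tnorm_nonneg _
  · refine rpow_sum_le_of_superadditive hd h0 hp1 hp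
      (Φ := fun G => tnorm k d θ (diagVec s a G)) (tnorm_nonneg _) (fun i => ?_)
      (sum_tnorm_diagVec_le h0 h1 hs a) h fun i hi => abs_pos.2 (Finset.mem_filter.1 hi).2
    have := abs_le_tnorm (d := d) h0 h1 (diagVec s a {i}) (diagSeq s i)
    rwa [diagVec_diagSeq hs, if_pos (Finset.mem_singleton_self i)] at this

end Diagonal

/-- The closed linear span of a sequence which is equivalent to the unit vector basis of `ℓ_p`
is isomorphic to `ℓ_p`. -/
theorem nonempty_closedSpan_equiv_lp {V : Type*} [NormedAddCommGroup V] [NormedSpace ℝ V]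
    [CompleteSpace V] {p : ENNReal} [Fact (1 ≤ p)] (hp : p ≠ ⊤) {v : ℕ → V} {c : ℝ} (hc : 0 < c)
    (hup : ∀ (a : ℕ → ℝ) (F : Finset ℕ),
      ‖∑ i ∈ F, a i • v i‖ ≤ ‖∑ i ∈ F, lp.single (E := fun _ : ℕ => ℝ) p i (a i)‖)
    (hlow : ∀ (a : ℕ → ℝ) (F : Finset ℕ),
      c * ‖∑ i ∈ F, lp.single (E := fun _ : ℕ => ℝ) p i (a i)‖ ≤ ‖∑ i ∈ F, a i • v i‖) :
    Nonempty ((Submodule.span ℝ (Set.range v)).topologicalClosure ≃L[ℝ]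
      lp (fun _ : ℕ => ℝ) p) := by
  have hlp : ∀ f : lp (fun _ : ℕ => ℝ) p, HasSum (fun i => lp.single p i (f i)) f :=
    lp.hasSum_single hp
  have hsum : ∀ f : lp (fun _ : ℕ => ℝ) p, Summable fun i => f i • v i := by
    intro f
    rw [summable_iff_vanishing_norm]
    intro ε hε
    obtain ⟨s, hs⟩ := summable_iff_vanishing_norm.1 (hlp f).summable ε hε
    exact ⟨s, fun t ht => (hup _ t).trans_lt (hs t ht)⟩
  let A₀ : lp (fun _ : ℕ => ℝ) p →ₗ[ℝ] V :=
    { toFun := fun f => ∑' i, f i • v i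
      map_add' := fun f g => by
        rw [← (hsum f).tsum_add (hsum g)]
        exact tsum_congr fun i => add_smul _ _ _
      map_smul' := fun r f => by
        rw [RingHom.id_apply, ← (hsum f).tsum_const_smul]
        exact tsum_congr fun i => mul_smul _ _ _ }
  have hA₀ : ∀ f, HasSum (fun i => f i • v i) (A₀ f) := fun f => (hsum f).hasSum
  have hA1 : ∀ f, ‖A₀ f‖ ≤ 1 * ‖f‖ := fun f => by
    rw [one_mul]
    exact le_of_tendsto_of_tendsto' (hA₀ f).norm (hlp f).norm fun F => hup _ F
  have hA2 : ∀ f, c * ‖f‖ ≤ ‖A₀ f‖ := fun f =>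
    le_of_tendsto_of_tendsto' ((hlp f).norm.const_mul c) (hA₀ f).norm fun F => hlow _ F
  let A : lp (fun _ : ℕ => ℝ) p →L[ℝ] V := A₀.mkContinuous 1 hA1
  have hanti : AntilipschitzWith (Real.toNNReal c⁻¹) A := by
    refine AddMonoidHomClass.antilipschitz_of_bound A fun f => ?_
    rw [Real.coe_toNNReal _ (inv_nonneg.2 hc.le), ← div_eq_inv_mul, le_div_iff₀' hc]
    exact hA2 f
  have hclosed : IsClosed (Set.range A) := hanti.isClosed_range A.uniformContinuous
  have hrange : A.range = (Submodule.span ℝ (Set.range v)).topologicalClosure := by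
    refine le_antisymm ?_ (Submodule.topologicalClosure_minimal _ ?_ hclosed)
    · rintro _ ⟨f, rfl⟩
      refine mem_closure_of_tendsto (hA₀ f) (Filter.Eventually.of_forall fun F => ?_)
      exact Submodule.sum_mem _ fun i _ =>
        Submodule.smul_mem _ _ (Submodule.subset_span ⟨i, rfl⟩)
    · rw [Submodule.span_le]
      rintro _ ⟨i, rfl⟩
      refine ⟨lp.single p i 1, ?_⟩
      refine (tsum_eq_single i fun j hj => ?_).trans ?_
      · rw [lp.single_apply_ne _ _ _ hj, zero_smul]
      · rw [lp.single_apply_self, one_smul]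
  rw [← hrange]
  exact ⟨(A.equivRange hanti.injective hclosed).symm⟩

/-- The unit vector `e_v`, as an element of `c_00`. -/
noncomputable def C00.unit {k : ℕ} (d : ℕ) (θ : Set.Ioo (0 : ℝ) 1) (v : Om k) : C00 k d θ :=
  show Om k →₀ ℝ from Finsupp.single v 1

theorem norm_sum_smul_e {k : ℕ} (d : ℕ) (θ : Set.Ioo (0 : ℝ) 1) (s : OmLE k) (a : ℕ → ℝ)
    (F : Finset ℕ) :
    ‖∑ i ∈ F, a i • e d θ (diagSeq s i)‖ = tnorm k d θ (diagVec s a F) := by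
  have h : ∑ i ∈ F, a i • e d θ (diagSeq s i) =
      UniformSpace.Completion.toComplₗᵢ (𝕜 := ℝ) (∑ i ∈ F, a i • C00.unit d θ (diagSeq s i)) := by
    rw [map_sum]
    refine Finset.sum_congr rfl fun i _ => ?_
    rw [map_smul]
    rfl
  rw [h, LinearIsometry.norm_map]
  refine congrArg (tnorm k d (θ : ℝ)) ?_
  exact Finset.sum_congr rfl fun i _ => Finsupp.smul_single_one (diagSeq s i) (a i)

theorem nonempty_diagSpace_equiv {k d : ℕ} (hd : 1 ≤ d) (θ : Set.Ioo (0 : ℝ) 1)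
    (hdθ : 1 < (d : ℝ) * (θ : ℝ)) {p : ℝ} (hp1 : 1 < p)
    (hp : (d : ℝ) * (θ : ℝ) = (d : ℝ) ^ (1 / p)) [Fact (1 ≤ ENNReal.ofReal p)]
    {s : OmLE k} (hs : s.1.length < k) : Nonempty (diagSpace d θ s ≃L[ℝ] EllP p) := by
  have hp0 : 0 < p := by linarith
  have hd2 : 2 ≤ d := by
    by_contra h
    obtain rfl : d = 1 := by omega
    have := θ.2.2
    rw [Nat.cast_one, one_mul] at hdθ
    linarith
  have hnorm : ∀ (a : ℕ → ℝ) (F : Finset ℕ),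
      ‖∑ i ∈ F, lp.single (E := fun _ : ℕ => ℝ) (ENNReal.ofReal p) i (a i)‖ =
        (∑ i ∈ F, |a i| ^ p) ^ (1 / p) := by
    intro a F
    have := lp.norm_sum_single (E := fun _ : ℕ => ℝ) (p := ENNReal.ofReal p)
      (by rwa [ENNReal.toReal_ofReal hp0.le]) a F
    simp only [ENNReal.toReal_ofReal hp0.le, Real.norm_eq_abs] at this
    rw [← this, ← Real.rpow_mul (norm_nonneg _), mul_one_div_cancel hp0.ne', Real.rpow_one]
  have hc : (0 : ℝ) < (1 / (2 * d) : ℝ) ^ (1 - 1 / p) := by positivity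
  refine nonempty_closedSpan_equiv_lp ENNReal.ofReal_ne_top hc (fun a F => ?_) fun a F => ?_
  · rw [norm_sum_smul_e, hnorm]
    exact tnorm_diagVec_le hd θ.2.1 hp1 hp hs a F
  · rw [norm_sum_smul_e, hnorm]
    exact le_tnorm_diagVec hd2 θ.2.1 θ.2.2 hp1 hp hs a F

theorem topTree_eq_diagSpace {k d : ℕ} (θ : Set.Ioo (0 : ℝ) 1) {s : OmLE k}
    (hs : s.1.length + 1 = k) : topTree d θ s = diagSpace d θ s := by
  have h : {v : Om k | s.1 <+: v.1} = Set.range (diagSeq s) := by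
    ext v
    have hk : k - s.1.length = 1 := by omega
    constructor
    · rintro ⟨w, hw⟩
      have hwl : w.length = 1 := by
        have := congrArg List.length hw
        rw [List.length_append, v.2.1] at this
        omega
      obtain ⟨b, rfl⟩ := List.length_eq_one_iff.1 hwl
      have hsb : s.1.getLastD 0 ≤ b := by
        have := getLastD_le_of_prefix ⟨[b], hw⟩ v.2.2
        rwa [← hw, getLastD_append_singleton] at this
      refine ⟨b - s.1.getLastD 0, Subtype.ext ?_⟩
      rw [← hw]
      simp only [diagSeq, hk, Nat.add_sub_cancel' hsb, List.replicate_one]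
    · rintro ⟨i, rfl⟩
      exact ⟨_, rfl⟩
  rw [topTree, diagSpace, h, ← Set.range_comp]
  rfl

end HDTsirelson

theorem mainTheorem7 (k d : ℕ) (hk : 2 ≤ k) (hd : 1 ≤ d) (θ : Set.Ioo (0 : ℝ) 1)
    (hdθ : 1 < (d : ℝ) * (θ : ℝ)) (p : ℝ) (hp1 : 1 < p)
    (hp : (d : ℝ) * (θ : ℝ) = (d : ℝ) ^ (1 / p)) :
    haveI : Fact (1 ≤ ENNReal.ofReal p) := HDTsirelson.fact_one_le_ofReal hp1
    (∀ s : HDTsirelson.OmLE k, s.1.length = k - 1 →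
      Nonempty (HDTsirelson.topTree d θ s ≃L[ℝ] HDTsirelson.EllP p)) ∧
    (∀ s : HDTsirelson.OmLE k, s.1.length < k →
      Nonempty (HDTsirelson.diagSpace d θ s ≃L[ℝ] HDTsirelson.EllP p)) := by
  have : Fact (1 ≤ ENNReal.ofReal p) := HDTsirelson.fact_one_le_ofReal hp1
  refine ⟨fun s hs => ?_, fun s hs => HDTsirelson.nonempty_diagSpace_equiv hd θ hdθ hp1 hp hs⟩
  rw [HDTsirelson.topTree_eq_diagSpace θ (by omega)]
  exact HDTsirelson.nonempty_diagSpace_equiv hd θ hdθ hp1 hp (by omega)
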